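/- Let $k=\mathbb F_q$ be a finite field with $q$ elements. A Kronecker module over $k$ is a finite-dimensional representation $M$ of the quiver with vertices $1,2$ and two arrows from $2$ to $1$, that is, a pair of finite-dimensional $k$-spaces $M_1,M_2$ with two linear maps $\alpha,\beta:M_2\to M_1$. Its dimension vector is $(\dim_k M_1,\dim_k M_2)$, and a submodule is a pair of subspaces $U_1\subseteq M_1$, $U_2\subseteq M_2$ with $\alpha(U_2),\beta(U_2)\subseteq U_1$. For a closed point $p\in\mathbb P^1_k$ and $t\ge 1$ let $R_p(t)$ be the regular indecomposable Kronecker module of regular length $t$ in the tube of $p$: if $p$ is the finite point given by a monic irreducible polynomial $f\in k[X]$, then $R_p(t)_1=R_p(t)_2=k[X]/(f^t)$ with $\alpha=\mathrm{id}$ and $\beta$ multiplication by $X$; if $p=\infty$ (a point of degree $1$), then $R_p(t)_1=R_p(t)_2=k[X]/(X^t)$ with $\alpha$ multiplication by $X$ and $\beta=\mathrm{id}$. For $l,a\in\mathbb Z$ put $$G^l_a(q)=\frac{(q^a-1)(q^{a-1}-1)\cdots(q^{a-l+1}-1)}{(q^l-1)(q^{l-1}-1)\cdots(q-1)}\ \text{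 if } l>0,\qquad G^0_a(q)=1,\qquad G^l_a(q)=0\ \text{ if } l<0.$$ **Theorem.** Let $t\ge 1$ be an integer, let $a,b\in\mathbb Z$, and let $p\in\mathbb P^1_k$ be a closed point of degree $1$. Then for every Kronecker module isomorphic to $R_p(t)$, the number of its submodules of dimension vector $(a,b)$ is finite and equals $$\begin{cases}0 & \text{if } a<0 \text{ or } b<0,\\ G^{t-a}_{t-b}(q)\,G^{a-b}_{a}(q) & \text{otherwise.}\end{cases}$$ -/

import Mathlib

open Polynomial

universe u v w

/-- A Kronecker module over `k`: a finite dimensional representation of the quiver with two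
vertices `1`, `2` and two arrows `α, β : 2 → 1`. -/
structure KroneckerModule (k : Type u) [Field k] where
  /-- the space at the vertex `1` (the sink) -/
  V₁ : Type v
  /-- the space at the vertex `2` (the source) -/
  V₂ : Type v
  [addCommGroup₁ : AddCommGroup V₁]
  [addCommGroup₂ : AddCommGroup V₂]
  [module₁ : Module k V₁]
  [module₂ : Module k V₂]
  [finite₁ : Module.Finite k V₁]
  [finite₂ : Module.Finite k V₂]
  α : V₂ →ₗ[k] V₁
  β : V₂ →ₗ[k] V₁

namespace KroneckerModule

attribute [instance] addCommGroup₁ addCommGroup₂ module₁ module₂ finite₁ finite₂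

variable {k : Type u} [Field k]

/-- An isomorphism of Kronecker modules. -/
structure Iso (M : KroneckerModule.{u, v} k) (N : KroneckerModule.{u, w} k) where
  e₁ : M.V₁ ≃ₗ[k] N.V₁
  e₂ : M.V₂ ≃ₗ[k] N.V₂
  map_α : ∀ x, e₁ (M.α x) = N.α (e₂ x)
  map_β : ∀ x, e₁ (M.β x) = N.β (e₂ x)

/-- A submodule of a Kronecker module: a pair of subspaces stable under both arrows. -/
structure Sub (M : KroneckerModule.{u, v} k) where
  U₁ : Submodule k M.V₁
  U₂ : Submodule k M.V₂
  α_mem : ∀ x ∈ U₂, M.α x ∈ U₁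
  β_mem : ∀ x ∈ U₂, M.β x ∈ U₁

/-- A submodule, regarded as a Kronecker module in its own right. -/
def Sub.toKroneckerModule {M : KroneckerModule.{u, v} k} (N : M.Sub) :
    KroneckerModule.{u, v} k where
  V₁ := N.U₁
  V₂ := N.U₂
  α := M.α.restrict N.α_mem
  β := M.β.restrict N.β_mem

/-- The dimension vector, with entries regarded as integers. -/
noncomputable def dimVector (M : KroneckerModule.{u, v} k) : ℤ × ℤ :=
  (Module.finrank k M.V₁, Module.finrank k M.V₂)

/-- The Grassmannian of submodules of `M` of dimension vector `(a, b)`. -/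
def Gr (M : KroneckerModule.{u, v} k) (a b : ℤ) : Set M.Sub :=
  {N | N.toKroneckerModule.dimVector = (a, b)}

end KroneckerModule

/-- The closed points of the projective line over `k`: the closed points of the affine line
`Spec k[X]`, i.e. the monic irreducible polynomials, and the point at infinity. -/
inductive ClosedPoint (k : Type u) [Field k] where
  | finite (f : k[X]) (monic : f.Monic) (irreducible : Irreducible f)
  | infinity

namespace ClosedPoint

variable {k : Type u} [Field k]

/-- The degree of a closed point, i.e. the degree of its residue field over `k`. -/
noncomputable def degree : ClosedPoint k → ℕ
  | finite f _ _ => f.natDegree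
  | infinity => 1

end ClosedPoint

/-- The regular indecomposable Kronecker module `R_p(t)` (which is `0` for `t = 0`).
For a finite point with polynomial `f` both spaces are `k[X]/(f ^ t)`, `α` is the identity and
`β` is multiplication by `X`; for the point at infinity both spaces are `k[X]/(X ^ t)`,
`α` is multiplication by `X` and `β` is the identity. -/
noncomputable def regularModule {k : Type u} [Field k] :
    ClosedPoint k → ℕ → KroneckerModule.{u, u} k
  | .finite f hf _, t =>
    { V₁ := AdjoinRoot (f ^ t)
      V₂ := AdjoinRoot (f ^ t)
      finite₁ := (hf.pow t).finite_adjoinRoot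
      finite₂ := (hf.pow t).finite_adjoinRoot
      α := LinearMap.id
      β := LinearMap.mulLeft k (AdjoinRoot.root (f ^ t)) }
  | .infinity, t =>
    { V₁ := AdjoinRoot ((X : k[X]) ^ t)
      V₂ := AdjoinRoot ((X : k[X]) ^ t)
      finite₁ := (monic_X.pow t).finite_adjoinRoot
      finite₂ := (monic_X.pow t).finite_adjoinRoot
      α := LinearMap.mulLeft k (AdjoinRoot.root ((X : k[X]) ^ t))
      β := LinearMap.id }

/-- The Gaussian coefficient `G^l_a(q)` for integers `l` and `a`, equal to
`(q^a - 1) ⋯ (q^(a-l+1) - 1) / ((q^l - 1) ⋯ (q - 1))` for `l > 0`, to `1` for `l = 0`,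
and to `0` for `l < 0`. -/
def gaussCoeff (q : ℚ) (l a : ℤ) : ℚ :=
  if l < 0 then 0
  else (∏ i ∈ Finset.range l.toNat, (q ^ (a - (i : ℤ)) - 1)) /
    ∏ i ∈ Finset.range l.toNat, (q ^ (i + 1) - 1)

theorem Set.ncard_sigma_of_const {α γ : Type*} {B : Set α} (hB : B.Finite) {R : α → Set γ} {c : ℕ}
    (hR : ∀ x ∈ B, (R x).Finite) (hc : ∀ x ∈ B, (R x).ncard = c) :
    {p : α × γ | p.1 ∈ B ∧ p.2 ∈ R p.1}.ncard = B.ncard * c := by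
  classical
  have := hB.fintype
  have hfin : ∀ x : B, Finite (R x) := fun x => hR x x.2
  let e : {p : α × γ | p.1 ∈ B ∧ p.2 ∈ R p.1} ≃ Σ x : B, R x :=
    { toFun := fun p => ⟨⟨p.1.1, p.2.1⟩, ⟨p.1.2, p.2.2⟩⟩
      invFun := fun s => ⟨(s.1.1, s.2.1), s.1.2, s.2.2⟩
      left_inv := fun _ => rfl
      right_inv := fun _ => rfl }
  rw [← Nat.card_coe_set_eq, Nat.card_congr e, Nat.card_sigma,
    Finset.sum_congr rfl fun (x : B) _ => (Nat.card_coe_set_eq _).trans (hc x x.2)]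
  rw [Finset.sum_const, smul_eq_mul, Finset.card_univ, ← Nat.card_eq_fintype_card,
    Nat.card_coe_set_eq]

/-- Double counting: two finite sets whose fibrations with constant fibre cardinalities have
the same total space. -/
theorem Set.ncard_mul_eq_ncard_mul {α β γ : Type*} {B : Set α} {B' : Set β}
    (hB : B.Finite) (hB' : B'.Finite) {R : α → Set γ} {R' : β → Set γ} {c c' : ℕ}
    (hR : ∀ x ∈ B, (R x).Finite) (hc : ∀ x ∈ B, (R x).ncard = c)
    (hR' : ∀ y ∈ B', (R' y).Finite) (hc' : ∀ y ∈ B', (R' y).ncard = c')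
    (f : α → γ → β) (g : β → γ → α)
    (hf : ∀ x ∈ B, ∀ w ∈ R x, f x w ∈ B' ∧ w ∈ R' (f x w) ∧ g (f x w) w = x)
    (hg : ∀ y ∈ B', ∀ w ∈ R' y, g y w ∈ B ∧ w ∈ R (g y w) ∧ f (g y w) w = y) :
    B.ncard * c = B'.ncard * c' := by
  rw [← Set.ncard_sigma_of_const hB hR hc, ← Set.ncard_sigma_of_const hB' hR' hc']
  refine Set.ncard_congr (fun p _ => (f p.1 p.2, p.2)) ?_ ?_ ?_
  · rintro ⟨x, w⟩ ⟨hx, hw⟩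
    exact ⟨(hf x hx w hw).1, (hf x hx w hw).2.1⟩
  · rintro ⟨x, w⟩ ⟨y, z⟩ ⟨hx, hw⟩ ⟨hy, hz⟩ h
    obtain ⟨h1, rfl⟩ := Prod.mk.inj h
    have h2 := (hf x hx w hw).2.2
    have h3 := (hf y hy w hz).2.2
    dsimp only at h1
    rw [← h2, ← h3, h1]
  · rintro ⟨y, w⟩ ⟨hy, hw⟩
    obtain ⟨h1, h2, h3⟩ := hg y hy w hw
    exact ⟨(g y w, w), ⟨h1, h2⟩, by simp [h3]⟩

section Hyperplane

variable {k E : Type*} [Field k] [AddCommGroup E] [Module k E] {φ : E →ₗ[k] k}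

theorem Submodule.exists_mem_apply_eq_one {U : Submodule k E} (h : ¬ U ≤ LinearMap.ker φ) :
    ∃ w ∈ U, φ w = 1 := by
  obtain ⟨x, hx, hx'⟩ := SetLike.not_le_iff_exists.1 h
  rw [LinearMap.mem_ker] at hx'
  exact ⟨(φ x)⁻¹ • x, U.smul_mem _ hx, by simp [hx']⟩

theorem Submodule.inf_ker_sup_span {U : Submodule k E} {w : E} (hw : w ∈ U) (h1 : φ w = 1) :
    U ⊓ LinearMap.ker φ ⊔ k ∙ w = U := by
  apply le_antisymm
  · exact sup_le inf_le_left ((Submodule.span_singleton_le_iff_mem _ _).2 hw)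
  · intro x hx
    refine Submodule.mem_sup.2 ⟨x - φ x • w, ⟨U.sub_mem hx (U.smul_mem _ hw), ?_⟩, φ x • w,
      Submodule.smul_mem _ _ (Submodule.mem_span_singleton_self w), by simp⟩
    simp [h1]

theorem Submodule.sup_span_inf_ker {U : Submodule k E} {w : E} (hU : U ≤ LinearMap.ker φ)
    (h1 : φ w = 1) : (U ⊔ k ∙ w) ⊓ LinearMap.ker φ = U := by
  apply le_antisymm
  · rintro x ⟨hx, hx'⟩
    obtain ⟨y, hy, z, hz, rfl⟩ := Submodule.mem_sup.1 hx
    obtain ⟨c, rfl⟩ := Submodule.mem_span_singleton.1 hz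
    have hy' : φ y = 0 := hU hy
    have hc : c = 0 := by simpa [hy', h1] using hx'
    simpa [hc] using hy
  · exact le_inf le_sup_left hU

theorem Submodule.finrank_sup_span {U : Submodule k E} [FiniteDimensional k U] {w : E}
    (hU : U ≤ LinearMap.ker φ) (h1 : φ w = 1) :
    Module.finrank k ↥(U ⊔ k ∙ w) = Module.finrank k U + 1 := by
  have h := Submodule.finrank_sup_add_finrank_inf_eq U (k ∙ w)
  have h0 : U ⊓ k ∙ w = ⊥ := by
    rw [eq_bot_iff]
    rintro x ⟨hx, hx'⟩
    obtain ⟨c, rfl⟩ := Submodule.mem_span_singleton.1 hx'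
    have hc : φ (c • w) = 0 := hU hx
    have hc : c = 0 := by simpa [h1] using hc
    simp [hc]
  have hw : w ≠ 0 := by
    rintro rfl
    simp at h1
  rw [h0, finrank_bot, finrank_span_singleton hw] at h
  simpa using h

theorem Submodule.finrank_inf_ker_add_one {U : Submodule k E} [FiniteDimensional k U]
    (h : ¬ U ≤ LinearMap.ker φ) :
    Module.finrank k ↥(U ⊓ LinearMap.ker φ) + 1 = Module.finrank k U := by
  obtain ⟨w, hw, h1⟩ := Submodule.exists_mem_apply_eq_one h
  have : FiniteDimensional k ↥(U ⊓ LinearMap.ker φ) :=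
    Submodule.finiteDimensional_of_le inf_le_left
  rw [← Submodule.finrank_sup_span inf_le_right h1, Submodule.inf_ker_sup_span hw h1]

theorem Submodule.ncard_apply_eq_one {U : Submodule k E} [FiniteDimensional k U]
    (h : ¬ U ≤ LinearMap.ker φ) :
    {w | w ∈ U ∧ φ w = 1}.ncard = Nat.card k ^ Module.finrank k ↥(U ⊓ LinearMap.ker φ) := by
  obtain ⟨w, hw, h1⟩ := Submodule.exists_mem_apply_eq_one h
  have : FiniteDimensional k ↥(U ⊓ LinearMap.ker φ) :=
    Submodule.finiteDimensional_of_le inf_le_left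
  rw [← Module.natCard_eq_pow_finrank, ← SetLike.coe_sort_coe, Nat.card_coe_set_eq]
  refine Set.ncard_congr (fun x _ => x - w) ?_ ?_ ?_
  · rintro x ⟨hx, hx'⟩
    exact ⟨U.sub_mem hx hw, by simp [hx', h1]⟩
  · intro x y _ _ hxy
    exact sub_left_injective hxy
  · rintro y ⟨hy, hy'⟩
    exact ⟨y + w, ⟨U.add_mem hy hw, by simp_all⟩, by simp⟩

end Hyperplane

/-! ### Gaussian binomials -/

/-- The product `(q - 1) (q ^ 2 - 1) ⋯ (q ^ n - 1)`. -/
def qFactorial (q : ℚ) (n : ℕ) : ℚ := ∏ i ∈ Finset.range n, (q ^ (i + 1) - 1)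

/-- The Gaussian binomial `[r + s choose r]`. -/
def qBinom (q : ℚ) (r s : ℕ) : ℚ := qFactorial q (r + s) / (qFactorial q r * qFactorial q s)

section QBinom

variable {q : ℚ}

theorem qFactorial_succ (n : ℕ) : qFactorial q (n + 1) = qFactorial q n * (q ^ (n + 1) - 1) :=
  Finset.prod_range_succ _ _

theorem pow_succ_sub_one_ne_zero (hq : 1 < q) (n : ℕ) : q ^ (n + 1) - 1 ≠ 0 :=
  sub_ne_zero.2 (one_lt_pow₀ hq n.succ_ne_zero).ne'

theorem qFactorial_ne_zero (hq : 1 < q) (n : ℕ) : qFactorial q n ≠ 0 :=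
  Finset.prod_ne_zero_iff.2 fun i _ => pow_succ_sub_one_ne_zero hq i

theorem qBinom_zero_left (hq : 1 < q) (s : ℕ) : qBinom q 0 s = 1 := by
  have := qFactorial_ne_zero hq s
  have h0 : qFactorial q 0 = 1 := Finset.prod_range_zero _
  simp [qBinom, h0, this]

theorem qBinom_zero_right (hq : 1 < q) (s : ℕ) : qBinom q s 0 = 1 := by
  have := qFactorial_ne_zero hq s
  have h0 : qFactorial q 0 = 1 := Finset.prod_range_zero _
  simp [qBinom, h0, this]

theorem qBinom_succ_succ (hq : 1 < q) (r s : ℕ) :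
    qBinom q (r + 1) (s + 1) = qBinom q r (s + 1) + q ^ (r + 1) * qBinom q (r + 1) s := by
  have h1 := qFactorial_ne_zero hq r
  have h2 := qFactorial_ne_zero hq s
  have h3 := pow_succ_sub_one_ne_zero hq r
  have h4 := pow_succ_sub_one_ne_zero hq s
  simp only [qBinom, show r + 1 + (s + 1) = r + s + 1 + 1 by ring,
    show r + (s + 1) = r + s + 1 by ring, show r + 1 + s = r + s + 1 by ring, qFactorial_succ]
  field_simp
  ring

theorem gaussCoeff_natCast_add (hq : 1 < q) (r s : ℕ) :
    gaussCoeff q (r : ℤ) ((r : ℤ) + s) = qBinom q r s := by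
  have h1 := qFactorial_ne_zero hq r
  have h2 := qFactorial_ne_zero hq s
  have key : qFactorial q (r + s) =
      qFactorial q s * ∏ i ∈ Finset.range r, (q ^ ((r : ℤ) + s - (i : ℤ)) - 1) := by
    rw [add_comm r s, qFactorial, Finset.prod_range_add, ← Finset.prod_range_reflect _ r]
    congr 1
    refine Finset.prod_congr rfl fun i hi => ?_
    have hi := Finset.mem_range.1 hi
    rw [← zpow_natCast]
    congr 2
    omega
  have h3 : gaussCoeff q (r : ℤ) ((r : ℤ) + s) =
      (∏ i ∈ Finset.range r, (q ^ ((r : ℤ) + s - (i : ℤ)) - 1)) / qFactorial q r := by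
    simp [gaussCoeff, qFactorial]
  rw [h3, qBinom, key]
  field_simp

end QBinom

/-! ### Pairs of subspaces of `k[X]` compatible with `divX` -/

section SubPairs

variable {k : Type*} [Field k]

instance Polynomial.degreeLT.finiteDimensional (t : ℕ) : FiniteDimensional k (degreeLT k t) :=
  Module.Finite.equiv (degreeLTEquiv k t).symm

theorem Polynomial.finrank_degreeLT (t : ℕ) : Module.finrank k (degreeLT k t) = t := by
  rw [(degreeLTEquiv k t).finrank_eq, Module.finrank_fin_fun]

theorem Polynomial.mem_degreeLT_iff_coeff {t : ℕ} {f : k[X]} :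
    f ∈ degreeLT k t ↔ ∀ m, t ≤ m → f.coeff m = 0 := by
  rw [mem_degreeLT, degree_lt_iff_coeff_zero]

theorem Polynomial.degreeLT_succ_inf_ker (t : ℕ) :
    degreeLT k (t + 1) ⊓ LinearMap.ker (lcoeff k t) = degreeLT k t := by
  ext f
  simp only [Submodule.mem_inf, mem_degreeLT_iff_coeff, LinearMap.mem_ker, lcoeff_apply]
  constructor
  · rintro ⟨h, h'⟩ m hm
    rcases hm.eq_or_lt with rfl | hm
    · exact h'
    · exact h m hm
  · exact fun h => ⟨fun m hm => h m (by omega), h t le_rfl⟩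

theorem Polynomial.le_degreeLT_iff {t : ℕ} {U : Submodule k k[X]} :
    U ≤ degreeLT k t ↔ U ≤ degreeLT k (t + 1) ∧ U ≤ LinearMap.ker (lcoeff k t) := by
  rw [← degreeLT_succ_inf_ker, le_inf_iff]

theorem Polynomial.divX_smul' (c : k) (f : k[X]) : (c • f).divX = c • f.divX := by
  ext
  simp [coeff_divX]

variable (k) in
/-- Pairs of subspaces `U₂ ⊆ U₁` of the polynomials of degree `< t`, of dimensions `b` and `a`,
such that `divX` maps `U₂` into `U₁`. -/
def subPairs (t a b : ℕ) : Set (Submodule k k[X] × Submodule k k[X]) :=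
  {P | P.1 ≤ degreeLT k t ∧ P.2 ≤ P.1 ∧ (∀ x ∈ P.2, x.divX ∈ P.1) ∧
    Module.finrank k P.1 = a ∧ Module.finrank k P.2 = b}

theorem subPairs_eq_empty {t a b : ℕ} (h : t < a ∨ a < b) : subPairs k t a b = ∅ := by
  rw [Set.eq_empty_iff_forall_notMem]
  rintro ⟨U₁, U₂⟩ ⟨h1, h2, -, h4, h5⟩
  dsimp only at *
  have := Submodule.finiteDimensional_of_le h1
  have h6 := Submodule.finrank_mono h1
  have h7 := Submodule.finrank_mono h2
  rw [finrank_degreeLT] at h6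
  omega

theorem subPairs_zero : subPairs k 0 0 0 = {(⊥, ⊥)} := by
  ext ⟨U₁, U₂⟩
  have h0 : degreeLT k 0 = ⊥ := Submodule.finrank_eq_zero.1 (finrank_degreeLT 0)
  simp only [subPairs, h0, Set.mem_ofPred_eq, Set.mem_singleton_iff, Prod.mk.injEq, le_bot_iff]
  constructor
  · rintro ⟨rfl, h2, -⟩
    exact ⟨rfl, le_bot_iff.1 h2⟩
  · rintro ⟨rfl, rfl⟩
    simp

theorem subPairs_succ_of_le (t a b : ℕ) :
    {P ∈ subPairs k (t + 1) a b | P.1 ≤ LinearMap.ker (lcoeff k t)} = subPairs k t a b := by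
  ext ⟨U₁, U₂⟩
  simp only [subPairs, Set.mem_ofPred_eq, le_degreeLT_iff (t := t)]
  tauto

/-- The number of lifts along `divX` to monic polynomials of degree `t`. -/
theorem ncard_divX_lift {t : ℕ} {U : Submodule k k[X]} (hU : U ≤ degreeLT k t)
    (hne : ∃ w ∈ degreeLT k (t + 1), lcoeff k t w = 1 ∧ w.divX ∈ U) :
    {w | w ∈ degreeLT k (t + 1) ∧ lcoeff k t w = 1 ∧ w.divX ∈ U}.ncard =
      Nat.card k ^ Module.finrank k U := by
  have := Submodule.finiteDimensional_of_le hU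
  obtain _ | t := t
  · have h0 : degreeLT k 0 = ⊥ := Submodule.finrank_eq_zero.1 (finrank_degreeLT 0)
    rw [h0, le_bot_iff] at hU
    subst hU
    rw [finrank_bot, pow_zero, Set.ncard_eq_one]
    refine ⟨1, Set.eq_singleton_iff_unique_mem.2 ⟨⟨?_, by simp, by simp⟩, ?_⟩⟩
    · rw [mem_degreeLT]
      simp
    · rintro x ⟨-, h1, h2⟩
      have h := divX_mul_X_add x
      rw [lcoeff_apply] at h1
      rw [(Submodule.mem_bot k).1 h2, h1] at h
      simpa using h.symm
  · obtain ⟨w, hw, hw1, hwU⟩ := hne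
    have hker : ¬ U ≤ LinearMap.ker (lcoeff k t) := by
      intro h
      have h' : lcoeff k t w.divX = 0 := h hwU
      rw [lcoeff_apply, coeff_divX] at h'
      rw [lcoeff_apply, h'] at hw1
      exact zero_ne_one hw1
    rw [← Submodule.finrank_inf_ker_add_one hker, pow_succ, mul_comm,
      ← Submodule.ncard_apply_eq_one hker, ← Set.ncard_univ, ← Set.ncard_prod]
    refine Set.ncard_congr (fun x _ => (x.coeff 0, x.divX)) ?_ ?_ ?_
    · rintro x ⟨-, hx1, hxU⟩
      exact ⟨Set.mem_univ _, hxU, by rwa [lcoeff_apply, coeff_divX]⟩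
    · intro x y _ _ hxy
      obtain ⟨h1, h2⟩ := Prod.mk.inj hxy
      rw [← divX_mul_X_add x, ← divX_mul_X_add y, h1, h2]
    · rintro ⟨c, u⟩ ⟨-, huU, hu1⟩
      have hdiv : (u * X + C c).divX = u := by
        ext
        simp [coeff_divX]
      refine ⟨u * X + C c, ⟨?_, ?_, ?_⟩, ?_⟩
      · rw [mem_degreeLT_iff_coeff]
        intro m hm
        obtain ⟨m, rfl⟩ : ∃ n, m = n + 1 := ⟨m - 1, by omega⟩
        simpa [coeff_C] using mem_degreeLT_iff_coeff.1 (hU huU) m (by omega)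
      · simpa [coeff_C] using hu1
      · rwa [hdiv]
      · rw [hdiv]
        simp

theorem exists_divX_lift_zero {U : Submodule k k[X]} :
    ∃ w ∈ degreeLT k (0 + 1), lcoeff k 0 w = 1 ∧ w.divX ∈ U :=
  ⟨1, by rw [mem_degreeLT]; simp, by simp, by simp⟩

theorem exists_divX_lift_succ_iff {t : ℕ} {U : Submodule k k[X]} (hU : U ≤ degreeLT k (t + 1)) :
    (∃ w ∈ degreeLT k (t + 1 + 1), lcoeff k (t + 1) w = 1 ∧ w.divX ∈ U) ↔
      ¬ U ≤ LinearMap.ker (lcoeff k t) := by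
  constructor
  · rintro ⟨w, -, hw1, hwU⟩ h
    have h' : lcoeff k t w.divX = 0 := h hwU
    rw [lcoeff_apply, coeff_divX] at h'
    rw [lcoeff_apply, h'] at hw1
    exact zero_ne_one hw1
  · intro h
    obtain ⟨u, hu, hu1⟩ := Submodule.exists_mem_apply_eq_one h
    refine ⟨u * X, ?_, by simpa using hu1, ?_⟩
    · rw [mem_degreeLT_iff_coeff]
      intro m hm
      obtain ⟨m, rfl⟩ : ∃ n, m = n + 1 := ⟨m - 1, by omega⟩
      simpa using mem_degreeLT_iff_coeff.1 (hU hu) m (by omega)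
    · have : (u * X).divX = u := by
        ext
        simp [coeff_divX]
      rwa [this]

theorem ncard_subPairs_lift_zero (a b : ℕ) :
    {P ∈ subPairs k 0 a b | ∃ w ∈ degreeLT k (0 + 1), lcoeff k 0 w = 1 ∧ w.divX ∈ P.1}.ncard =
      (subPairs k 0 a b).ncard := by
  congr 1
  ext P
  exact and_iff_left exists_divX_lift_zero

variable [Finite k]

theorem Polynomial.finite_degreeLT (t : ℕ) : (degreeLT k t : Set k[X]).Finite :=
  have := Module.finite_of_finite k (M := degreeLT k t)
  Set.toFinite _

theorem finite_subPairs (t a b : ℕ) : (subPairs k t a b).Finite := by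
  have h : {U : Submodule k k[X] | U ≤ degreeLT k t}.Finite := by
    refine Set.Finite.of_finite_image (f := fun U => (U : Set k[X]))
      ((finite_degreeLT t).finite_subsets.subset ?_) SetLike.coe_injective.injOn
    rintro _ ⟨U, hU, rfl⟩
    exact hU
  exact (h.prod h).subset fun P hP => ⟨hP.1, hP.2.1.trans hP.1⟩

/-- The pairs whose first but not second member contains a polynomial of degree `t`. -/
theorem ncard_subPairs_left (t a b : ℕ) :
    {P ∈ subPairs k (t + 1) (a + 1) b | ¬ P.1 ≤ LinearMap.ker (lcoeff k t) ∧
      P.2 ≤ LinearMap.ker (lcoeff k t)}.ncard * Nat.card k ^ a =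
    (subPairs k t a b).ncard * Nat.card k ^ t := by
  refine Set.ncard_mul_eq_ncard_mul ((finite_subPairs _ _ _).sep _) (finite_subPairs _ _ _)
    (R := fun P => {w | w ∈ P.1 ∧ lcoeff k t w = 1})
    (R' := fun P => {w | w ∈ degreeLT k (t + 1) ∧ lcoeff k t w = 1}) ?_ ?_ ?_ ?_
    (fun P _ => (P.1 ⊓ LinearMap.ker (lcoeff k t), P.2)) (fun P w => (P.1 ⊔ k ∙ w, P.2)) ?_ ?_
  · rintro P ⟨hP, -⟩
    exact (finite_degreeLT (t + 1)).subset fun w hw => hP.1 hw.1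
  · rintro P ⟨hP, hP', -⟩
    have := Submodule.finiteDimensional_of_le hP.1
    rw [Submodule.ncard_apply_eq_one hP']
    have := Submodule.finrank_inf_ker_add_one hP'
    rw [hP.2.2.2.1] at this
    rw [Nat.add_right_cancel this]
  · intro P _
    exact (finite_degreeLT (t + 1)).subset fun w hw => hw.1
  · intro P _
    have h : ¬ degreeLT k (t + 1) ≤ LinearMap.ker (lcoeff k t) := by
      intro h
      have := Submodule.finrank_mono (le_degreeLT_iff.2 ⟨le_rfl, h⟩)
      simp [finrank_degreeLT] at this
    rw [Submodule.ncard_apply_eq_one h, degreeLT_succ_inf_ker, finrank_degreeLT]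
  · rintro ⟨U₁, U₂⟩ ⟨⟨h1, h2, h3, h4, h5⟩, h6, h7⟩ w ⟨hw, hw'⟩
    dsimp only at *
    have := Submodule.finiteDimensional_of_le h1
    refine ⟨⟨?_, le_inf h2 h7, fun x hx => ⟨h3 x hx, ?_⟩, ?_, h5⟩, ⟨h1 hw, hw'⟩, ?_⟩
    · exact le_degreeLT_iff.2 ⟨inf_le_left.trans h1, inf_le_right⟩
    · simpa [coeff_divX] using mem_degreeLT_iff_coeff.1 (h1 (h2 hx)) (t + 1) le_rfl
    · have := Submodule.finrank_inf_ker_add_one h6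
      dsimp only
      omega
    · rw [Submodule.inf_ker_sup_span hw hw']
  · rintro ⟨U₁, U₂⟩ ⟨h1, h2, h3, h4, h5⟩ w ⟨hw, hw'⟩
    dsimp only at *
    have := Submodule.finiteDimensional_of_le h1
    obtain ⟨h1', h6⟩ := le_degreeLT_iff.1 h1
    have hmem : w ∈ U₁ ⊔ k ∙ w := Submodule.mem_sup_right (Submodule.mem_span_singleton_self w)
    refine ⟨⟨⟨sup_le h1' ((Submodule.span_singleton_le_iff_mem _ _).2 hw), h2.trans le_sup_left,
      fun x hx => Submodule.mem_sup_left (h3 x hx), ?_, h5⟩, fun h => ?_, h2.trans h6⟩,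
      ⟨hmem, hw'⟩, ?_⟩
    · rw [Submodule.finrank_sup_span h6 hw', h4]
    · have : lcoeff k t w = 0 := h hmem
      simp [hw'] at this
    · rw [Submodule.sup_span_inf_ker h6 hw']

theorem ncard_subPairs_right (t a b : ℕ) :
    {P ∈ subPairs k (t + 1) (a + 1) (b + 1) | ¬ P.2 ≤ LinearMap.ker (lcoeff k t)}.ncard *
      Nat.card k ^ b =
    {P ∈ subPairs k t a b | ∃ w ∈ degreeLT k (t + 1), lcoeff k t w = 1 ∧ w.divX ∈ P.1}.ncard *
      Nat.card k ^ a := by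
  refine Set.ncard_mul_eq_ncard_mul ((finite_subPairs _ _ _).sep _) ((finite_subPairs _ _ _).sep _)
    (R := fun P => {w | w ∈ P.2 ∧ lcoeff k t w = 1})
    (R' := fun P => {w | w ∈ degreeLT k (t + 1) ∧ lcoeff k t w = 1 ∧ w.divX ∈ P.1}) ?_ ?_ ?_ ?_
    (fun P _ => (P.1 ⊓ LinearMap.ker (lcoeff k t), P.2 ⊓ LinearMap.ker (lcoeff k t)))
    (fun P w => (P.1 ⊔ k ∙ w, P.2 ⊔ k ∙ w)) ?_ ?_
  · rintro P ⟨hP, -⟩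
    exact (finite_degreeLT (t + 1)).subset fun w hw => hP.1 (hP.2.1 hw.1)
  · rintro P ⟨hP, hP'⟩
    have := Submodule.finiteDimensional_of_le (hP.2.1.trans hP.1)
    rw [Submodule.ncard_apply_eq_one hP']
    have := Submodule.finrank_inf_ker_add_one hP'
    rw [hP.2.2.2.2] at this
    rw [Nat.add_right_cancel this]
  · intro P _
    exact (finite_degreeLT (t + 1)).subset fun w hw => hw.1
  · rintro P ⟨hP, hP'⟩
    rw [ncard_divX_lift hP.1 hP', hP.2.2.2.1]
  · rintro ⟨U₁, U₂⟩ ⟨⟨h1, h2, h3, h4, h5⟩, h6⟩ w ⟨hw, hw'⟩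
    dsimp only at *
    have := Submodule.finiteDimensional_of_le h1
    have := Submodule.finiteDimensional_of_le h2
    have hdiv : ∀ x ∈ U₂, x.divX ∈ U₁ ⊓ LinearMap.ker (lcoeff k t) := fun x hx => ⟨h3 x hx, by
      simpa [coeff_divX] using mem_degreeLT_iff_coeff.1 (h1 (h2 hx)) (t + 1) le_rfl⟩
    refine ⟨⟨⟨?_, inf_le_inf_right _ h2, fun x hx => hdiv x hx.1, ?_, ?_⟩,
      w, h1 (h2 hw), hw', hdiv w hw⟩, ⟨h1 (h2 hw), hw', hdiv w hw⟩, ?_⟩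
    · exact le_degreeLT_iff.2 ⟨inf_le_left.trans h1, inf_le_right⟩
    · have := Submodule.finrank_inf_ker_add_one fun h => h6 (h2.trans h)
      dsimp only
      omega
    · have := Submodule.finrank_inf_ker_add_one h6
      dsimp only
      omega
    · rw [Submodule.inf_ker_sup_span hw hw', Submodule.inf_ker_sup_span (h2 hw) hw']
  · rintro ⟨U₁, U₂⟩ ⟨⟨h1, h2, h3, h4, h5⟩, -⟩ w ⟨hw, hw', hwU⟩
    dsimp only at *
    have := Submodule.finiteDimensional_of_le h1
    have := Submodule.finiteDimensional_of_le h2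
    obtain ⟨h1', h6⟩ := le_degreeLT_iff.1 h1
    have hmem : w ∈ U₂ ⊔ k ∙ w := Submodule.mem_sup_right (Submodule.mem_span_singleton_self w)
    refine ⟨⟨⟨sup_le h1' ((Submodule.span_singleton_le_iff_mem _ _).2 hw),
      sup_le_sup_right h2 _, ?_, ?_, ?_⟩, fun h => ?_⟩, ⟨hmem, hw'⟩, ?_⟩
    · intro x hx
      obtain ⟨y, hy, z, hz, rfl⟩ := Submodule.mem_sup.1 hx
      obtain ⟨c, rfl⟩ := Submodule.mem_span_singleton.1 hz
      rw [divX_add, divX_smul']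
      exact Submodule.mem_sup_left (U₁.add_mem (h3 y hy) (U₁.smul_mem c hwU))
    · rw [Submodule.finrank_sup_span h6 hw', h4]
    · rw [Submodule.finrank_sup_span (h2.trans h6) hw', h5]
    · have : lcoeff k t w = 0 := h hmem
      simp [hw'] at this
    · rw [Submodule.sup_span_inf_ker h6 hw', Submodule.sup_span_inf_ker (h2.trans h6) hw']

theorem ncard_subPairs_succ (t a b : ℕ) :
    (subPairs k (t + 1) a b).ncard = (subPairs k t a b).ncard +
      {P ∈ subPairs k (t + 1) a b | ¬ P.1 ≤ LinearMap.ker (lcoeff k t) ∧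
        P.2 ≤ LinearMap.ker (lcoeff k t)}.ncard +
      {P ∈ subPairs k (t + 1) a b | ¬ P.2 ≤ LinearMap.ker (lcoeff k t)}.ncard := by
  rw [← subPairs_succ_of_le t a b, ← Set.ncard_union_eq _ ((finite_subPairs _ _ _).sep _)
    ((finite_subPairs _ _ _).sep _), ← Set.ncard_union_eq _
    (((finite_subPairs _ _ _).sep _).union ((finite_subPairs _ _ _).sep _))
    ((finite_subPairs _ _ _).sep _)]
  · congr 1
    ext P
    simp only [Set.mem_union, Set.mem_ofPred_eq]
    tauto
  · rw [Set.disjoint_left]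
    rintro P (⟨hP, h⟩ | ⟨-, -, h⟩) ⟨-, h'⟩
    · exact h' (hP.2.1.trans h)
    · exact h' h
  · rw [Set.disjoint_left]
    rintro P ⟨-, h⟩ ⟨-, h', -⟩
    exact h' h

theorem ncard_subPairs_lift_succ (t a b : ℕ) :
    {P ∈ subPairs k (t + 1) a b | ∃ w ∈ degreeLT k (t + 1 + 1),
      lcoeff k (t + 1) w = 1 ∧ w.divX ∈ P.1}.ncard + (subPairs k t a b).ncard =
      (subPairs k (t + 1) a b).ncard := by
  rw [← subPairs_succ_of_le t a b, ← Set.ncard_union_eq _ ((finite_subPairs _ _ _).sep _)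
    ((finite_subPairs _ _ _).sep _)]
  · congr 1
    ext P
    simp only [Set.mem_union, Set.mem_ofPred_eq]
    by_cases hP : P ∈ subPairs k (t + 1) a b
    · simp only [hP, true_and, exists_divX_lift_succ_iff hP.1]
      tauto
    · simp [hP]
  · rw [Set.disjoint_left]
    rintro P ⟨hP, h⟩ ⟨-, h'⟩
    exact (exists_divX_lift_succ_iff hP.1).1 h h'

theorem ncard_subPairs (t r s b : ℕ) (h : r + s + b = t) :
    ((subPairs k t (s + b) b).ncard : ℚ) =
      qBinom (Nat.card k) r s * qBinom (Nat.card k) s b := by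
  have hq : (1 : ℚ) < Nat.card k := by exact_mod_cast Finite.one_lt_card
  have hpos : 0 < Nat.card k := Nat.card_pos
  induction t using Nat.strong_induction_on generalizing r s b with
  | _ t ih =>
  obtain _ | t := t
  · obtain ⟨rfl, rfl, rfl⟩ : r = 0 ∧ s = 0 ∧ b = 0 := by omega
    simp [subPairs_zero, qBinom_zero_left hq]
  have hA : ((subPairs k t (s + b) b).ncard : ℚ) =
      (if r = 0 then 0 else qBinom (Nat.card k) (r - 1) s) * qBinom (Nat.card k) s b := by
    obtain _ | r := r
    · simp [subPairs_eq_empty (k := k) (t := t) (a := s + b) (b := b) (by omega)]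
    · simpa using ih t (by omega) r s b (by omega)
  have hB : (({P ∈ subPairs k (t + 1) (s + b) b | ¬ P.1 ≤ LinearMap.ker (lcoeff k t) ∧
      P.2 ≤ LinearMap.ker (lcoeff k t)}.ncard : ℕ) : ℚ) =
      if s = 0 then 0 else
        Nat.card k ^ r * (qBinom (Nat.card k) r (s - 1) * qBinom (Nat.card k) (s - 1) b) := by
    obtain _ | s := s
    · have : {P ∈ subPairs k (t + 1) (0 + b) b | ¬ P.1 ≤ LinearMap.ker (lcoeff k t) ∧
          P.2 ≤ LinearMap.ker (lcoeff k t)} = ∅ := by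
        rw [Set.eq_empty_iff_forall_notMem]
        rintro P ⟨hP, h1, h2⟩
        have := Submodule.finiteDimensional_of_le hP.1
        refine h1 ((Submodule.eq_of_le_of_finrank_eq hP.2.1 ?_) ▸ h2)
        rw [hP.2.2.2.1, hP.2.2.2.2, zero_add]
      rw [this]
      simp
    · have h1 := ncard_subPairs_left (k := k) t (s + b) b
      rw [show Nat.card k ^ t = Nat.card k ^ r * Nat.card k ^ (s + b) by
        rw [← pow_add, show r + (s + b) = t by omega], ← mul_assoc] at h1
      have h2 := Nat.eq_of_mul_eq_mul_right (pow_pos hpos _) h1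
      rw [show s + 1 + b = s + b + 1 by ring, h2]
      push_cast
      rw [ih t (by omega) r s b (by omega)]
      simp [mul_comm]
  have hC : (({P ∈ subPairs k (t + 1) (s + b) b | ¬ P.2 ≤ LinearMap.ker (lcoeff k t)}.ncard : ℕ) :
      ℚ) = if b = 0 then 0 else Nat.card k ^ s * (qBinom (Nat.card k) s (b - 1) *
        (qBinom (Nat.card k) r s - if r = 0 then 0 else qBinom (Nat.card k) (r - 1) s)) := by
    obtain _ | b := b
    · have : {P ∈ subPairs k (t + 1) (s + 0) 0 | ¬ P.2 ≤ LinearMap.ker (lcoeff k t)} = ∅ := by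
        rw [Set.eq_empty_iff_forall_notMem]
        rintro P ⟨hP, h1⟩
        have := Submodule.finiteDimensional_of_le (hP.2.1.trans hP.1)
        exact h1 (Submodule.finrank_eq_zero.1 hP.2.2.2.2 ▸ bot_le)
      rw [this]
      simp
    · have h1 := ncard_subPairs_right (k := k) t (s + b) b
      rw [pow_add (Nat.card k) s b, ← mul_assoc] at h1
      have h2 := Nat.eq_of_mul_eq_mul_right (pow_pos hpos _) h1
      rw [show s + (b + 1) = s + b + 1 by ring, h2]
      push_cast
      have h3 := ih t (by omega) r s b (by omega)
      obtain _ | t := t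
      · obtain ⟨rfl, rfl, rfl⟩ : r = 0 ∧ s = 0 ∧ b = 0 := by omega
        rw [ncard_subPairs_lift_zero, h3]
        simp
      · have h4 := ncard_subPairs_lift_succ (k := k) t (s + b) b
        obtain _ | r := r
        · rw [subPairs_eq_empty (k := k) (t := t) (by omega), Set.ncard_empty, add_zero] at h4
          rw [h4, h3]
          simp
          ring
        · have h5 := ih t (by omega) r s b (by omega)
          rw [← h4] at h3
          push_cast at h3
          simp only [Nat.add_eq_zero_iff, one_ne_zero, and_false, if_false, Nat.add_sub_cancel]
          linear_combination (Nat.card k : ℚ) ^ s * (h3 - h5)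
  rw [ncard_subPairs_succ]
  push_cast
  rw [hA, hB, hC]
  obtain _ | r := r <;> obtain _ | s := s <;> obtain _ | b := b <;>
    simp [qBinom_zero_left hq, qBinom_zero_right hq] at h ⊢
  · rw [qBinom_succ_succ hq s b]
  · linear_combination -qBinom_succ_succ hq r s
  · have h1 := qBinom_succ_succ hq r s
    have h2 := qBinom_succ_succ hq s b
    linear_combination ((Nat.card k : ℚ) ^ (s + 1) * qBinom (Nat.card k) (s + 1) b -
      qBinom (Nat.card k) (s + 1) (b + 1)) * h1 -
      (Nat.card k : ℚ) ^ (r + 1) * qBinom (Nat.card k) (r + 1) s * h2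

end SubPairs

/-! ### The regular modules at points of degree one in terms of `divX` -/

section Model

variable {k : Type u} [Field k]

/-- Evaluation of the polynomial `p` of degree `< t`, with its coefficients reversed, at `f`. -/
noncomputable def reverseEval (f : k[X]) (t : ℕ) : k[X] →ₗ[k] k[X] :=
  ∑ i ∈ Finset.range t, (LinearMap.toSpanSingleton k k[X] (f ^ (t - 1 - i))).comp (lcoeff k i)

theorem reverseEval_apply (f : k[X]) (t : ℕ) (p : k[X]) :
    reverseEval f t p = ∑ i ∈ Finset.range t, p.coeff i • f ^ (t - 1 - i) := by
  simp [reverseEval]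

theorem reverseEval_eq_comp (f : k[X]) (t : ℕ) (p : k[X]) :
    reverseEval f t p = (reverseEval X t p).comp f := by
  simp [reverseEval_apply, Polynomial.sum_comp, smul_comp]

theorem coeff_reverseEval_X {t i : ℕ} (hi : i < t) (p : k[X]) :
    (reverseEval X t p).coeff (t - 1 - i) = p.coeff i := by
  rw [reverseEval_apply, finsetSum_coeff, Finset.sum_eq_single i]
  · simp
  · intro j hj hji
    have := Finset.mem_range.1 hj
    rw [coeff_smul, coeff_X_pow, if_neg (by omega), smul_zero]
  · intro h
    exact absurd (Finset.mem_range.2 hi) h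

theorem reverseEval_mem_degreeLT {f : k[X]} (hf : f.natDegree = 1) (t : ℕ) (p : k[X]) :
    reverseEval f t p ∈ degreeLT k t := by
  rw [reverseEval_apply]
  refine Submodule.sum_mem _ fun i hi => Submodule.smul_mem _ _ ?_
  have := Finset.mem_range.1 hi
  have hf0 : f ≠ 0 := by
    rintro rfl
    simp at hf
  rw [mem_degreeLT, degree_pow, degree_eq_natDegree hf0, hf]
  simp only [Nat.cast_one, nsmul_eq_mul, mul_one, Nat.cast_lt]
  omega

theorem eq_zero_of_reverseEval_eq_zero {f : k[X]} (hf : f.natDegree = 1) {t : ℕ} {p : k[X]}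
    (hp : p ∈ degreeLT k t) (h : reverseEval f t p = 0) : p = 0 := by
  rw [reverseEval_eq_comp, comp_eq_zero_iff] at h
  have h : reverseEval X t p = 0 := by
    refine h.resolve_right fun h => ?_
    rw [h.2, natDegree_C] at hf
    exact zero_ne_one hf
  ext i
  rw [coeff_zero]
  by_cases hi : i < t
  · rw [← coeff_reverseEval_X hi, h, coeff_zero]
  · exact mem_degreeLT_iff_coeff.1 hp i (by omega)

theorem mul_reverseEval {t : ℕ} {p : k[X]} (hp : p ∈ degreeLT k t) (f : k[X]) :
    f * reverseEval f t p = reverseEval f t p.divX + p.coeff 0 • f ^ t := by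
  obtain _ | t := t
  · simp [reverseEval_apply, mem_degreeLT_iff_coeff.1 hp 0 le_rfl]
  · rw [reverseEval_apply, reverseEval_apply, Finset.sum_range_succ', Finset.sum_range_succ, mul_add,
      Finset.mul_sum, coeff_divX, mem_degreeLT_iff_coeff.1 hp (t + 1) le_rfl]
    have h : ∀ i ∈ Finset.range t, f * p.coeff (i + 1) • f ^ (t + 1 - 1 - (i + 1)) =
        p.divX.coeff i • f ^ (t + 1 - 1 - i) := by
      intro i hi
      have := Finset.mem_range.1 hi
      rw [coeff_divX, mul_smul_comm, ← pow_succ', show t + 1 - 1 - (i + 1) + 1 = t + 1 - 1 - i by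
        omega]
    rw [Finset.sum_congr rfl h]
    simp [pow_succ']

theorem divX_mem_degreeLT {t : ℕ} {p : k[X]} (hp : p ∈ degreeLT k t) : p.divX ∈ degreeLT k t :=
  mem_degreeLT_iff_coeff.2 fun m hm => by
    rw [coeff_divX]
    exact mem_degreeLT_iff_coeff.1 hp _ (by omega)

theorem AdjoinRoot.exists_linearMap_degreeLT {f : k[X]} {c : k} (hf : f = X - C c) (t : ℕ) :
    ∃ g : AdjoinRoot (f ^ t) →ₗ[k] k[X], Function.Injective g ∧ LinearMap.range g = degreeLT k t ∧
      ∀ y, g (AdjoinRoot.root (f ^ t) * y) = (g y).divX + c • g y := by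
  have hmonic : f.Monic := hf ▸ monic_X_sub_C c
  have hdeg : f.natDegree = 1 := hf ▸ natDegree_X_sub_C c
  let Ψ : degreeLT k t →ₗ[k] AdjoinRoot (f ^ t) :=
    ((AdjoinRoot.mkₐ (f ^ t) : k[X] →ₐ[k] AdjoinRoot (f ^ t)).toLinearMap ∘ₗ
      reverseEval f t) ∘ₗ (degreeLT k t).subtype
  have hΨ : ∀ p, Ψ p = AdjoinRoot.mk (f ^ t) (reverseEval f t p) := fun _ => rfl
  have hinj : Function.Injective Ψ := by
    rw [injective_iff_map_eq_zero]
    rintro ⟨p, hp⟩ h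
    rw [hΨ, AdjoinRoot.mk_eq_zero] at h
    refine Subtype.ext (eq_zero_of_reverseEval_eq_zero hdeg hp ?_)
    refine eq_zero_of_dvd_of_degree_lt h ?_
    rw [degree_eq_natDegree (hmonic.pow t).ne_zero, natDegree_pow, hdeg, mul_one]
    exact mem_degreeLT.1 (reverseEval_mem_degreeLT hdeg t p)
  have hfin : Module.Finite k (AdjoinRoot (f ^ t)) := (hmonic.pow t).finite_adjoinRoot
  have hrank : Module.finrank k (degreeLT k t) = Module.finrank k (AdjoinRoot (f ^ t)) := by
    rw [finrank_degreeLT, (AdjoinRoot.powerBasis' (hmonic.pow t)).finrank,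
      AdjoinRoot.powerBasis'_dim, natDegree_pow, hdeg, mul_one]
  let e := LinearEquiv.ofInjectiveOfFinrankEq Ψ hinj hrank
  have he : ∀ p, e p = Ψ p := fun _ => rfl
  refine ⟨(degreeLT k t).subtype ∘ₗ e.symm.toLinearMap,
    Subtype.val_injective.comp e.symm.injective, ?_, fun y => ?_⟩
  · rw [LinearMap.range_comp_of_range_eq_top _ (LinearEquiv.range e.symm), Submodule.range_subtype]
  · obtain ⟨⟨p, hp⟩, rfl⟩ := e.surjective y
    have key : AdjoinRoot.root (f ^ t) * e ⟨p, hp⟩ =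
        e (⟨p.divX, divX_mem_degreeLT hp⟩ + c • ⟨p, hp⟩) := by
      have h := congrArg (AdjoinRoot.mk (f ^ t)) (mul_reverseEval hp f)
      have h0 : AdjoinRoot.mk (f ^ t) (p.coeff 0 • f ^ t) = 0 := by
        rw [AdjoinRoot.mk_eq_zero, smul_eq_C_mul]
        exact dvd_mul_left _ _
      have hr : AdjoinRoot.mk (f ^ t) f =
          AdjoinRoot.root (f ^ t) - algebraMap k (AdjoinRoot (f ^ t)) c := by
        rw [AdjoinRoot.algebraMap_eq, ← AdjoinRoot.mk_X, ← AdjoinRoot.mk_C, ← map_sub, ← hf]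
      rw [map_add, map_mul, h0, add_zero, hr, sub_mul, ← Algebra.smul_def, sub_eq_iff_eq_add] at h
      rw [map_add, map_smul, he, he, hΨ, hΨ]
      exact h
    rw [key]
    simp

end Model

namespace KroneckerModule

variable {k : Type u} [Field k]

theorem Sub.ext_of_eq {M : KroneckerModule.{u, v} k} {N N' : M.Sub} (h₁ : N.U₁ = N'.U₁)
    (h₂ : N.U₂ = N'.U₂) : N = N' := by
  cases N
  cases N'
  simp_all

theorem mem_Gr_iff {M : KroneckerModule.{u, v} k} {a b : ℤ} {N : M.Sub} :
    N ∈ M.Gr a b ↔ (Module.finrank k N.U₁ : ℤ) = a ∧ (Module.finrank k N.U₂ : ℤ) = b :=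
  Prod.mk_inj

theorem Gr_eq_empty {M : KroneckerModule.{u, v} k} {a b : ℤ} (h : a < 0 ∨ b < 0) :
    M.Gr a b = ∅ := by
  rw [Set.eq_empty_iff_forall_notMem]
  intro N hN
  have := mem_Gr_iff.1 hN
  omega

theorem finite_Gr_and_ncard_eq [Finite k] {M : KroneckerModule.{u, v} k} {t : ℕ}
    (g₁ : M.V₁ →ₗ[k] k[X]) (g₂ : M.V₂ →ₗ[k] k[X])
    (hg₁ : Function.Injective g₁) (hg₂ : Function.Injective g₂)
    (hr₁ : LinearMap.range g₁ = degreeLT k t) (hr₂ : LinearMap.range g₂ = degreeLT k t)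
    (h : ∀ (U : Submodule k k[X]) (x : M.V₂),
      g₁ (M.α x) ∈ U ∧ g₁ (M.β x) ∈ U ↔ g₂ x ∈ U ∧ (g₂ x).divX ∈ U) (a b : ℕ) :
    (M.Gr a b).Finite ∧ (M.Gr a b).ncard = (subPairs k t a b).ncard := by
  let F : M.Sub → Submodule k k[X] × Submodule k k[X] := fun N => (N.U₁.map g₁, N.U₂.map g₂)
  have hF : Function.Injective F := by
    intro N N' hN
    obtain ⟨h1, h2⟩ := Prod.mk.inj hN
    exact Sub.ext_of_eq (Submodule.map_injective_of_injective hg₁ h1)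
      (Submodule.map_injective_of_injective hg₂ h2)
  have hd₁ : ∀ U : Submodule k M.V₁, Module.finrank k (U.map g₁) = Module.finrank k U := fun U =>
    (Submodule.equivMapOfInjective g₁ hg₁ U).finrank_eq.symm
  have hd₂ : ∀ U : Submodule k M.V₂, Module.finrank k (U.map g₂) = Module.finrank k U := fun U =>
    (Submodule.equivMapOfInjective g₂ hg₂ U).finrank_eq.symm
  have himage : F '' M.Gr a b = subPairs k t a b := by
    ext ⟨U₁, U₂⟩
    constructor
    · rintro ⟨N, hN, hNU⟩
      obtain ⟨rfl, rfl⟩ := Prod.mk.inj hNU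
      obtain ⟨ha, hb⟩ := mem_Gr_iff.1 hN
      have hstable : ∀ x ∈ N.U₂, g₂ x ∈ N.U₁.map g₁ ∧ (g₂ x).divX ∈ N.U₁.map g₁ := fun x hx =>
        (h _ x).1 ⟨Submodule.mem_map_of_mem (N.α_mem x hx),
          Submodule.mem_map_of_mem (N.β_mem x hx)⟩
      refine ⟨hr₁ ▸ LinearMap.map_le_range, ?_, ?_, ?_, ?_⟩
      · rintro _ ⟨x, hx, rfl⟩
        exact (hstable x hx).1
      · rintro _ ⟨x, hx, rfl⟩
        exact (hstable x hx).2
      · rw [hd₁]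
        exact_mod_cast ha
      · rw [hd₂]
        exact_mod_cast hb
    · rintro ⟨h1, h2, h3, h4, h5⟩
      dsimp only at *
      have hmap₁ : (U₁.comap g₁).map g₁ = U₁ := Submodule.map_comap_eq_self (hr₁ ▸ h1)
      have hmap₂ : (U₂.comap g₂).map g₂ = U₂ := Submodule.map_comap_eq_self (hr₂ ▸ h2.trans h1)
      have hstable : ∀ x ∈ U₂.comap g₂, g₁ (M.α x) ∈ U₁ ∧ g₁ (M.β x) ∈ U₁ := fun x hx =>
        (h U₁ x).2 ⟨h2 hx, h3 _ hx⟩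
      refine ⟨⟨U₁.comap g₁, U₂.comap g₂, fun x hx => (hstable x hx).1,
        fun x hx => (hstable x hx).2⟩, mem_Gr_iff.2 ⟨?_, ?_⟩, Prod.ext hmap₁ hmap₂⟩
      · rw [← hd₁, hmap₁, h4]
      · rw [← hd₂, hmap₂, h5]
  refine ⟨Set.Finite.of_finite_image (himage ▸ finite_subPairs t a b) hF.injOn, ?_⟩
  rw [← himage, Set.ncard_image_of_injective _ hF]

end KroneckerModule

theorem regularModule_finite_Gr_and_ncard_eq {k : Type u} [Field k] [Finite k]
    {p : ClosedPoint k} (hp : p.degree = 1) {t : ℕ} {M : KroneckerModule.{u, v} k}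
    (e : M.Iso (regularModule p t)) (a b : ℕ) :
    (M.Gr a b).Finite ∧ (M.Gr a b).ncard = (subPairs k t a b).ncard := by
  cases p with
  | finite f hf hirr =>
    obtain ⟨g, hinj, hr, hg⟩ := AdjoinRoot.exists_linearMap_degreeLT (f := f) (c := -f.coeff 0)
      (by rw [C_neg, sub_neg_eq_add]; exact hf.eq_X_add_C hp) t
    refine KroneckerModule.finite_Gr_and_ncard_eq (g ∘ₗ e.e₁.toLinearMap) (g ∘ₗ e.e₂.toLinearMap)
      (hinj.comp e.e₁.injective) (hinj.comp e.e₂.injective)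
      ((LinearMap.range_comp_of_range_eq_top _ (LinearEquiv.range e.e₁)).trans hr)
      ((LinearMap.range_comp_of_range_eq_top _ (LinearEquiv.range e.e₂)).trans hr)
      (fun U x => ?_) a b
    have hα : g (e.e₁ (M.α x)) = g (e.e₂ x) := congrArg g (e.map_α x)
    have hβ : g (e.e₁ (M.β x)) = (g (e.e₂ x)).divX + (-f.coeff 0) • g (e.e₂ x) :=
      (congrArg g (e.map_β x)).trans (hg _)
    change g (e.e₁ (M.α x)) ∈ U ∧ g (e.e₁ (M.β x)) ∈ U ↔ g (e.e₂ x) ∈ U ∧ (g (e.e₂ x)).divX ∈ U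
    rw [hα, hβ]
    exact and_congr_right fun hx => Submodule.add_mem_iff_left _ (U.smul_mem _ hx)
  | infinity =>
    obtain ⟨g, hinj, hr, hg⟩ := AdjoinRoot.exists_linearMap_degreeLT (f := (X : k[X])) (c := 0)
      (by simp) t
    refine KroneckerModule.finite_Gr_and_ncard_eq (g ∘ₗ e.e₁.toLinearMap) (g ∘ₗ e.e₂.toLinearMap)
      (hinj.comp e.e₁.injective) (hinj.comp e.e₂.injective)
      ((LinearMap.range_comp_of_range_eq_top _ (LinearEquiv.range e.e₁)).trans hr)
      ((LinearMap.range_comp_of_range_eq_top _ (LinearEquiv.range e.e₂)).trans hr)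
      (fun U x => ?_) a b
    have hα : g (e.e₁ (M.α x)) = (g (e.e₂ x)).divX :=
      (congrArg g (e.map_α x)).trans ((hg _).trans (by rw [zero_smul, add_zero]))
    have hβ : g (e.e₁ (M.β x)) = g (e.e₂ x) := congrArg g (e.map_β x)
    change g (e.e₁ (M.α x)) ∈ U ∧ g (e.e₁ (M.β x)) ∈ U ↔ g (e.e₂ x) ∈ U ∧ (g (e.e₂ x)).divX ∈ U
    rw [hα, hβ, and_comm]

theorem theorem4p6 {k : Type u} [Field k] [Finite k]
    (p : ClosedPoint k) (hp : p.degree = 1) (t : ℕ) (ht : 1 ≤ t)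
    (M : KroneckerModule.{u, v} k) (hM : Nonempty (M.Iso (regularModule p t))) (a b : ℤ) :
    (M.Gr a b).Finite ∧
      ((M.Gr a b).ncard : ℚ) =
        if a < 0 ∨ b < 0 then 0
        else gaussCoeff (Nat.card k : ℚ) ((t : ℤ) - a) ((t : ℤ) - b) *
          gaussCoeff (Nat.card k : ℚ) (a - b) a := by
  have hq : (1 : ℚ) < Nat.card k := by exact_mod_cast Finite.one_lt_card
  split_ifs with h
  · simp [KroneckerModule.Gr_eq_empty h]
  obtain ⟨e⟩ := hM
  lift a to ℕ using by omega
  lift b to ℕ using by omega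
  obtain ⟨hfin, hcard⟩ := regularModule_finite_Gr_and_ncard_eq hp e a b
  refine ⟨hfin, ?_⟩
  rw [hcard]
  by_cases hab : t < a ∨ a < b
  · rw [subPairs_eq_empty hab, Set.ncard_empty, Nat.cast_zero]
    rcases hab with hab | hab
    · simp [gaussCoeff, show (t : ℤ) < a by exact_mod_cast hab]
    · simp [gaussCoeff, show (a : ℤ) < b by exact_mod_cast hab]
  · obtain ⟨s, rfl⟩ : ∃ s, a = s + b := ⟨a - b, by omega⟩
    obtain ⟨r, rfl⟩ : ∃ r, t = r + s + b := ⟨t - (s + b), by omega⟩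
    rw [ncard_subPairs _ r s b rfl, ← gaussCoeff_natCast_add hq, ← gaussCoeff_natCast_add hq]
    congr 2 <;> push_cast <;> ring
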